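/- **Setting.** There are $K$ arms. Arm $i$ has a reward distribution with CDF $F_i$ and finite mean $\mu_i$; $i^*$ is the unique arm with the largest mean, $\mu^*=\mu_{i^*}$ and $\Delta_j=\mu^*-\mu_j$. In round $t=1,2,\dots$ the player picks an arm $I_t$ from the information available after round $t-1$. The clean reward $\tilde X_{i,t}$ of arm $i$ has CDF $F_i$ and is independent of the past (everything that happened in rounds $1,\dots,t-1$). An adversary attacks in round $t$ with probability $\rho$, independently of the past. The player observes $X_t=\tilde X_{I_t,t}+\eta_t$ if there is an attack and $X_t=\tilde X_{I_t,t}$ otherwise. The attack value $\eta_t$ is an arbitrary, unbounded real random variable that may depend on the whole past, on $I_t$, on the current clean rewards and on extra randomness (but not on the future). The pseudo-regret is $\bar R_T=\mu^*T-\mathbb E\sum_{t=1}^T\mu_{I_t}$. For $0<p<1$ let $\theta_p(F)=\inf\{x\in\mathbb R: F(x)\ge p\}$; the sample median of a finite sample is $\theta_{1/2}$ of its empirical CDF. **Algorithm med-E-UCB** with parameters $b,\omega$ and integer group size $G\ge 2$ with $G\ge Kb\log G$. In the first $K\lceil b\log G\rceil$ rounds each arm is pulled $\lceil b\log G\rceil$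 times. For a later round $t$, put $k=\lfloor t/G\rfloor$ and, if $k\ge1$, $D_k=\lceil b\log((k+1)G)\rceil-\lceil b\log(kG)\rceil$. If $k\ge 1$ and $kG+1\le t\le kG+KD_k$, pull $I_t=\lceil (t-kG)/D_k\rceil$. Otherwise pull an arm $I_t$ that maximizes $\mathrm{med}_j(t-1)+\sqrt{\omega\log t/T_j(t-1)}$ over $j$ (ties broken arbitrarily), where $T_j(t-1)$ is the number of pulls of arm $j$ up to round $t-1$ and $\mathrm{med}_j(t-1)$ is the sample median of the rewards observed in these pulls. **Assumption.** There are constants $0<s<\tfrac12$, $l>0$ and $\xi>0$ such that $\theta_{1/2-s}(F_{i^*})>\theta_{1/2+s}(F_j)$ for all $j\ne i^*$, every $F_i$ is differentiable, $F_{i^*}'\ge l$ on $(\theta_{1/2-s}(F_{i^*})-\xi,\ \theta_{1/2-s}(F_{i^*}))$, and $F_j'\ge l$ on $(\theta_{1/2+s}(F_j),\ \theta_{1/2+s}(F_j)+\xi)$ for all $j\neq i^*$. **Theorem.** Suppose the assumption holds, $0\le\rho<s$, $b\ge\max\{\omega/\xi^2,\ 2/(s-\rho)^2\}$ and $\omega\ge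 2/l^2$. Then for every attack of the above kind and every $T>G$ the pseudo-regret of med-E-UCB satisfies $$\bar R_T\le\sum_{j\ne i^*}\Delta_j\left(b\log(2T)+\frac{4\omega\log T}{\bigl(\theta_{1/2-s}(F_{i^*})-\theta_{1/2+s}(F_j)\bigr)^2}+2+\frac{2\pi^2}{3}\right).$$ Consequently $\bar R_T=\mathcal O(\log T)$: there are $M,\zeta>0$ that depend only on the arm distributions, $s$, $b$ and $\omega$ such that $\bar R_T\le M\log T$ for all $T>G$ with $T\ge\zeta$. -/

import Mathlib

open MeasureTheory ProbabilityTheory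

namespace MedBandit

noncomputable section

/-- Generalized `p`-quantile of a cumulative distribution function `F`:
`inf {x : F x ≥ p}` (for `0 < p < 1`). -/
def quantile (F : ℝ → ℝ) (p : ℝ) : ℝ := sInf {x | p ≤ F x}

/-- Empirical distribution function of the finite sample `(x τ)`, `τ ∈ Q`. -/
def empiricalCDF (Q : Finset ℕ) (x : ℕ → ℝ) (y : ℝ) : ℝ :=
  ((Q.filter fun τ => x τ ≤ y).card : ℝ) / (Q.card : ℝ)

/-- Mean of a reward distribution. -/
def mean (ν : Measure ℝ) : ℝ := ∫ x, x ∂ν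

/-- The rounds among `1, …, t` in which arm `j` is pulled, for a sequence of pulls `I`. -/
def pullTimes {K : ℕ} (I : ℕ → Fin K) (j : Fin K) (t : ℕ) : Finset ℕ :=
  (Finset.Icc 1 t).filter fun τ => I τ = j

/-- Number of pulls of arm `j` in the rounds `1, …, t`. -/
def numPulls {K : ℕ} (I : ℕ → Fin K) (j : Fin K) (t : ℕ) : ℕ := (pullTimes I j t).card

/-- Sample median (the `1/2`-quantile of the empirical distribution) of the rewards observed
from arm `j` in the rounds `1, …, t`; `X τ` is the reward observed in round `τ`. -/
def sampleMedian {K : ℕ} (I : ℕ → Fin K) (X : ℕ → ℝ) (j : Fin K) (t : ℕ) : ℝ :=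
  quantile (empiricalCDF (pullTimes I j t) X) (1 / 2)

/-- The median-based upper confidence index of arm `j` at round `t`. -/
def ucbIndex {K : ℕ} (ω : ℝ) (I : ℕ → Fin K) (X : ℕ → ℝ) (t : ℕ) (j : Fin K) : ℝ :=
  sampleMedian I X j (t - 1) + Real.sqrt (ω * Real.log t / (numPulls I j (t - 1) : ℝ))

/-- `⌈b log (k G)⌉`. -/
def exploreLevel (b : ℝ) (G k : ℕ) : ℕ := ⌈b * Real.log ((k : ℝ) * (G : ℝ))⌉₊

/-- Number `⌈b log ((k+1) G)⌉ - ⌈b log (k G)⌉` of pure exploration pulls per arm at the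
beginning of block `k ≥ 1`. -/
def exploreSize (b : ℝ) (G k : ℕ) : ℕ := exploreLevel b G (k + 1) - exploreLevel b G k

/-- Round `t` (after the initialization) is a pure exploration round: with `k = ⌊t / G⌋`,
`kG + 1 ≤ t ≤ kG + K (⌈b log ((k+1) G)⌉ - ⌈b log (k G)⌉)`. The block `k = 0` contains no such
round after the initialization. -/
def IsExploration (K : ℕ) (b : ℝ) (G t : ℕ) : Prop :=
  1 ≤ t / G ∧ t / G * G + 1 ≤ t ∧ t ≤ t / G * G + K * exploreSize b G (t / G)

/-- The sequence of pulls `I` (rounds are numbered `1, 2, …`) follows the algorithm med-E-UCB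
with parameters `b`, `ω` and group size `G` when the observed rewards are `X`. The order of the
pulls in the initialization and the way ties are broken are arbitrary. -/
structure IsMedEUCB {K : ℕ} (b ω : ℝ) (G : ℕ) (I : ℕ → Fin K) (X : ℕ → ℝ) : Prop where
  /-- In the first `K ⌈b log G⌉` rounds each arm is pulled `⌈b log G⌉` times. -/
  init : ∀ j, numPulls I j (K * exploreLevel b G 1) = exploreLevel b G 1
  /-- Pure exploration; arms are numbered from `0` here, hence the `+ 1`. -/
  explore : ∀ t, K * exploreLevel b G 1 < t → IsExploration K b G t →
    (I t : ℕ) + 1 =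
      ⌈((t : ℝ) - ((t / G : ℕ) : ℝ) * (G : ℝ)) / (exploreSize b G (t / G) : ℝ)⌉₊
  /-- All other rounds pull an arm with maximal index. -/
  ucb : ∀ t, K * exploreLevel b G 1 < t → ¬ IsExploration K b G t →
    ∀ j, ucbIndex ω I X t j ≤ ucbIndex ω I X t (I t)

/-- A stochastic bandit with arm distributions `ν` played under attacks that occur with
probability `ρ` in each round; rounds are numbered `1, 2, …`, and `ℱ t` is all the information
(of player, adversary and environment, private randomization included) after round `t`.

The attack value is unbounded and adaptive: it is any function of the whole past, of the current
arm, of the current clean rewards and of extra randomness. -/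
structure AttackedBandit {K : ℕ} (ν : Fin K → Measure ℝ) (ρ : ℝ) {Ω : Type*}
    [mΩ : MeasurableSpace Ω] (P : Measure Ω) where
  /-- Information available after each round. -/
  ℱ : Filtration ℕ mΩ
  /-- `arm t` is the arm pulled in round `t`. -/
  arm : ℕ → Ω → Fin K
  /-- `clean i t` is the clean reward of arm `i` in round `t`. -/
  clean : Fin K → ℕ → Ω → ℝ
  /-- Whether the adversary attacks in round `t`. -/
  attacks : ℕ → Ω → Bool
  /-- `attackValue t` is added to the reward if the adversary attacks in round `t`. -/
  attackValue : ℕ → Ω → ℝ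
  /-- The arm is chosen before the round is played. -/
  measurable_arm : ∀ t, Measurable[ℱ t] (arm (t + 1))
  measurable_clean : ∀ i t, Measurable[ℱ (t + 1)] (clean i (t + 1))
  measurable_attacks : ∀ t, Measurable[ℱ (t + 1)] (attacks (t + 1))
  measurable_attackValue : ∀ t, Measurable[ℱ (t + 1)] (attackValue (t + 1))
  /-- Clean rewards of arm `i` have distribution `ν i` and are independent of the past. -/
  law_clean : ∀ i t, P.map (clean i (t + 1)) = ν i
  indep_clean : ∀ i t, Indep (MeasurableSpace.comap (clean i (t + 1)) inferInstance) (ℱ t) P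
  /-- The adversary attacks with probability `ρ`, independently of the past. -/
  prob_attacks : ∀ t, P.real {w | attacks (t + 1) w = true} = ρ
  indep_attacks : ∀ t, Indep (MeasurableSpace.comap (attacks (t + 1)) inferInstance) (ℱ t) P

namespace AttackedBandit

variable {K : ℕ} {ν : Fin K → Measure ℝ} {ρ : ℝ} {Ω : Type*} [mΩ : MeasurableSpace Ω]
  {P : Measure Ω}

/-- The reward observed by the player in round `t`. -/
def observed (B : AttackedBandit ν ρ P) (t : ℕ) (w : Ω) : ℝ :=
  B.clean (B.arm t w) t w + if B.attacks t w = true then B.attackValue t w else 0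

/-- The player uses med-E-UCB on the observed rewards. -/
def PlaysMedEUCB (B : AttackedBandit ν ρ P) (b ω : ℝ) (G : ℕ) : Prop :=
  ∀ w, IsMedEUCB b ω G (fun t => B.arm t w) (fun t => B.observed t w)

/-- Pseudo-regret `μ* T - E[∑_{t=1}^T μ_{I_t}]`, where `istar` is the optimal arm. -/
def pseudoRegret (B : AttackedBandit ν ρ P) (istar : Fin K) (T : ℕ) : ℝ :=
  mean (ν istar) * (T : ℝ) - ∫ w, ∑ t ∈ Finset.Icc 1 T, mean (ν (B.arm t w)) ∂P

end AttackedBandit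

/-- Quantile gap between the optimal arm and the others, differentiable distribution functions,
and a density that is at least `l` on one-sided `ξ`-neighbourhoods of the quantiles. -/
structure QuantileGap {K : ℕ} (ν : Fin K → Measure ℝ) (istar : Fin K) (s l ξ : ℝ) : Prop where
  s_pos : 0 < s
  s_lt_half : s < 1 / 2
  l_pos : 0 < l
  ξ_pos : 0 < ξ
  gap : ∀ j, j ≠ istar →
    quantile (cdf (ν j)) (1 / 2 + s) < quantile (cdf (ν istar)) (1 / 2 - s)
  differentiable : ∀ i, Differentiable ℝ (fun x => cdf (ν i) x)
  density_opt : ∀ x, quantile (cdf (ν istar)) (1 / 2 - s) - ξ < x →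
    x < quantile (cdf (ν istar)) (1 / 2 - s) → l ≤ deriv (fun y => cdf (ν istar) y) x
  density_subopt : ∀ j, j ≠ istar → ∀ x, quantile (cdf (ν j)) (1 / 2 + s) < x →
    x < quantile (cdf (ν j)) (1 / 2 + s) + ξ → l ≤ deriv (fun y => cdf (ν j) y) x

end

end MedBandit

namespace MedBandit

/-! An attack, however large, corrupts a single observation, and a median moves past a level only if
at least half of the sample lies on the wrong side. Call a pull of an arm a hit if its clean reward
lies in a bad half-line or if it is attacked. At distance `ε ≤ ξ` beyond the relevant quantile, the
density bound leaves the half-line mass at most `1/2 - s - l * ε`, so a hit has conditional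
probability at most `1/2 - δ` with `δ = s - ρ + l * ε`. A misled median requires hits in at least
half of the pulls.

Pulls are chosen adaptively, so the number of hits is not binomial. An exponential supermartingale
(`integral_weight_le_one`) and Markov's inequality still give the tail `exp (-2 δ² n)` for exactly
`n` pulls (`measureReal_manyHits_le`), and a union bound over `n` handles the random number of
pulls. With `ε` the confidence radius capped at `ξ`, the conditions on `b` and `ω` make the failure
probability at most `1 / t ^ 2` (`two_log_le_sq_mul`), provided that the arm has at least `(b / 4)
log t` pulls. Forced exploration guarantees this (`IsMedEUCB.le_numPulls`).

Each pull of a suboptimal arm is thus forced, or among its first few, or follows a misleading sample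
(`pulls_le`). Taking expectations and decomposing the regret by arms gives the bound. -/

/-! ### Quantiles and tail masses of the arm distributions -/

lemma cdf_quantile (μ : Measure ℝ) [IsProbabilityMeasure μ]
    (hc : Continuous fun x => cdf μ x) {p : ℝ} (h0 : 0 < p) (h1 : p < 1) :
    cdf μ (quantile (cdf μ) p) = p := by
  obtain ⟨x₀, hx₀⟩ := ((tendsto_cdf_atBot μ).eventually (gt_mem_nhds h0)).exists
  obtain ⟨x₁, hx₁⟩ := ((tendsto_cdf_atTop μ).eventually (lt_mem_nhds h1)).exists
  have hbdd : BddBelow {x | p ≤ cdf μ x} := by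
    refine ⟨x₀, fun x hx => le_of_not_gt fun hlt => ?_⟩
    exact absurd (hx₀.trans_le (le_trans hx (monotone_cdf μ hlt.le))) (lt_irrefl _)
  have hmem : quantile (cdf μ) p ∈ {x | p ≤ cdf μ x} :=
    (isClosed_le continuous_const hc).csInf_mem ⟨x₁, hx₁.le⟩ hbdd
  obtain ⟨x, hx⟩ := mem_range_of_exists_le_of_exists_ge hc ⟨x₀, hx₀.le⟩ ⟨x₁, hx₁.le⟩
  refine le_antisymm ?_ hmem
  calc cdf μ (quantile (cdf μ) p) ≤ cdf μ x := monotone_cdf μ (csInf_le hbdd hx.ge)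
    _ = p := hx

/-- By continuity the distribution function equals `1/2 + s` at the quantile, and the mean value
inequality makes it grow by at least `l * ε` to the right of it. `tail_opt` is the mirror image. -/
lemma QuantileGap.tail_subopt {K : ℕ} {ν : Fin K → Measure ℝ} [∀ i, IsProbabilityMeasure (ν i)]
    {istar : Fin K} {s l ξ : ℝ} (h : QuantileGap ν istar s l ξ) {j : Fin K} (hj : j ≠ istar)
    {ε : ℝ} (h0 : 0 ≤ ε) (hε : ε ≤ ξ) :
    (ν j).real (Set.Ioi (quantile (cdf (ν j)) (1 / 2 + s) + ε)) ≤ 1 / 2 - s - l * ε := by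
  set θ := quantile (cdf (ν j)) (1 / 2 + s) with hθ
  have hs := h.s_pos
  have hs' := h.s_lt_half
  have hd := h.differentiable j
  have hq : cdf (ν j) θ = 1 / 2 + s :=
    cdf_quantile (ν j) hd.continuous (by linarith) (by linarith)
  have hmvt := (convex_Icc θ (θ + ε)).mul_sub_le_image_sub_of_le_deriv
    (f := fun x => cdf (ν j) x) hd.continuous.continuousOn hd.differentiableOn (C := l)
    (by
      intro x hx
      rw [interior_Icc] at hx
      exact h.density_subopt j hj x hx.1 (by linarith [hx.2]))
    θ (by simp [h0]) (θ + ε) (by simp [h0]) (by linarith)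
  have hcompl : (ν j).real (Set.Ioi (θ + ε)) = 1 - cdf (ν j) (θ + ε) := by
    rw [cdf_eq_real, ← Set.compl_Iic, probReal_compl_eq_one_sub measurableSet_Iic]
  simp only [add_sub_cancel_left, hq] at hmvt
  rw [hcompl]
  linarith

lemma QuantileGap.tail_opt {K : ℕ} {ν : Fin K → Measure ℝ} [∀ i, IsProbabilityMeasure (ν i)]
    {istar : Fin K} {s l ξ : ℝ} (h : QuantileGap ν istar s l ξ)
    {ε : ℝ} (h0 : 0 ≤ ε) (hε : ε ≤ ξ) :
    (ν istar).real (Set.Iic (quantile (cdf (ν istar)) (1 / 2 - s) - ε)) ≤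
      1 / 2 - s - l * ε := by
  set θ := quantile (cdf (ν istar)) (1 / 2 - s) with hθ
  have hs := h.s_pos
  have hs' := h.s_lt_half
  have hd := h.differentiable istar
  have hq : cdf (ν istar) θ = 1 / 2 - s :=
    cdf_quantile (ν istar) hd.continuous (by linarith) (by linarith)
  have hmvt := (convex_Icc (θ - ε) θ).mul_sub_le_image_sub_of_le_deriv
    (f := fun x => cdf (ν istar) x) hd.continuous.continuousOn hd.differentiableOn (C := l)
    (by
      intro x hx
      rw [interior_Icc] at hx
      exact h.density_opt x (by linarith [hx.1]) hx.2)
    (θ - ε) (by simp [h0]) θ (by simp [h0]) (by linarith)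
  simp only [sub_sub_cancel, hq] at hmvt
  rw [← cdf_eq_real]
  linarith

/-! ### Sample medians by counting -/

section Median

variable {Q : Finset ℕ} {x : ℕ → ℝ} {y : ℝ}

lemma half_le_empiricalCDF_iff (hQ : Q.Nonempty) :
    1 / 2 ≤ empiricalCDF Q x y ↔ Q.card ≤ 2 * (Q.filter fun τ => x τ ≤ y).card := by
  have hpos : (0 : ℝ) < Q.card := by exact_mod_cast hQ.card_pos
  rw [empiricalCDF, le_div_iff₀ hpos]
  constructor
  · intro h
    have : (Q.card : ℝ) ≤ 2 * ((Q.filter fun τ => x τ ≤ y).card : ℝ) := by linarith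
    exact_mod_cast this
  · intro h
    have : (Q.card : ℝ) ≤ 2 * ((Q.filter fun τ => x τ ≤ y).card : ℝ) := by exact_mod_cast h
    linarith

/-- The real `sInf` is meaningful only for a set bounded below; the sample minimum is such a bound.
-/
lemma median_le (hQ : Q.Nonempty) (h : Q.card ≤ 2 * (Q.filter fun τ => x τ ≤ y).card) :
    quantile (empiricalCDF Q x) (1 / 2) ≤ y := by
  refine csInf_le ⟨Q.inf' hQ x, fun z hz => ?_⟩ ((half_le_empiricalCDF_iff hQ).2 h)
  have hz' := (half_le_empiricalCDF_iff hQ).1 hz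
  have hne : (Q.filter fun τ => x τ ≤ z).Nonempty := by
    rw [← Finset.card_pos]
    have := hQ.card_pos
    omega
  obtain ⟨τ, hτ⟩ := hne
  rw [Finset.mem_filter] at hτ
  exact (Finset.inf'_le x hτ.1).trans hτ.2

lemma le_median (hQ : Q.Nonempty) (h : 2 * (Q.filter fun τ => x τ ≤ y).card < Q.card) :
    y ≤ quantile (empiricalCDF Q x) (1 / 2) := by
  refine le_csInf ⟨Q.sup' hQ x, (half_le_empiricalCDF_iff hQ).2 ?_⟩ fun z hz => ?_
  · rw [Finset.filter_true_of_mem fun τ hτ => Finset.le_sup' x hτ]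
    omega
  · have hz' := (half_le_empiricalCDF_iff hQ).1 hz
    by_contra! hlt
    have : (Q.filter fun τ => x τ ≤ z).card ≤ (Q.filter fun τ => x τ ≤ y).card :=
      Finset.card_le_card (Finset.monotone_filter_right Q fun τ _ hτ => le_trans hτ hlt.le)
    omega

end Median

/-! ### Counting pulls and forced exploration -/

section Counting

variable {K : ℕ} {I : ℕ → Fin K} {j : Fin K}

lemma pullTimes_mono {t t' : ℕ} (h : t ≤ t') : pullTimes I j t ⊆ pullTimes I j t' :=
  Finset.filter_subset_filter _ (Finset.Icc_subset_Icc_right h)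

lemma numPulls_mono {t t' : ℕ} (h : t ≤ t') : numPulls I j t ≤ numPulls I j t' :=
  Finset.card_le_card (pullTimes_mono h)

lemma numPulls_le (t : ℕ) : numPulls I j t ≤ t := by
  simpa [numPulls, pullTimes] using Finset.card_filter_le (Finset.Icc 1 t) fun τ => I τ = j

lemma numPulls_pred_lt {τ τ' : ℕ} (h1 : 1 ≤ τ) (hlt : τ < τ') (hτ : I τ = j) :
    numPulls I j (τ - 1) < numPulls I j (τ' - 1) := by
  refine Finset.card_lt_card (Finset.ssubset_iff_of_subset (pullTimes_mono (by omega)) |>.2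
    ⟨τ, ?_, ?_⟩)
  · simp only [pullTimes, Finset.mem_filter, Finset.mem_Icc]
    exact ⟨⟨h1, by omega⟩, hτ⟩
  · simp only [pullTimes, Finset.mem_filter, Finset.mem_Icc]
    omega

/-- At most `u + 1` pulls of an arm happen while it has been pulled at most `u` times before. -/
lemma card_pulls_of_numPulls_le (T u : ℕ) :
    ((pullTimes I j T).filter fun t => numPulls I j (t - 1) ≤ u).card ≤ u + 1 := by
  rw [← Finset.card_range (u + 1)]
  -- The number of earlier pulls strictly increases from one pull of `j` to the next, hence labels
  -- these pulls injectively.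
  refine Finset.card_le_card_of_injOn (fun t => numPulls I j (t - 1)) ?_ ?_
  · intro t ht
    simp only [Finset.coe_filter, Set.mem_ofPred_eq] at ht
    simp only [Finset.coe_range, Set.mem_Iio]
    omega
  · intro t ht t' ht' heq
    simp only [pullTimes, Finset.coe_filter, Finset.mem_filter, Finset.mem_Icc,
      Set.mem_ofPred_eq] at ht ht' heq
    rcases lt_trichotomy t t' with h | h | h
    · exact absurd heq (numPulls_pred_lt ht.1.1.1 h ht.1.2).ne
    · exact h
    · exact absurd heq (numPulls_pred_lt ht'.1.1.1 h ht'.1.2).ne'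

lemma exploreLevel_mono {b : ℝ} (hb : 0 ≤ b) {G : ℕ} (hG : 1 ≤ G) {k k' : ℕ} (hk : 1 ≤ k)
    (hkk : k ≤ k') : exploreLevel b G k ≤ exploreLevel b G k' := by
  unfold exploreLevel
  have hk' : (1 : ℝ) ≤ k := by exact_mod_cast hk
  have hG' : (1 : ℝ) ≤ G := by exact_mod_cast hG
  gcongr

/-- The sum telescopes; monotonicity keeps the natural subtraction in `exploreSize` from truncating.
-/
lemma exploreLevel_add_sum {b : ℝ} (hb : 0 ≤ b) {G : ℕ} (hG : 1 ≤ G) (n : ℕ) :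
    exploreLevel b G 1 + ∑ k ∈ Finset.Icc 1 n, exploreSize b G k = exploreLevel b G (n + 1) := by
  induction n with
  | zero => simp
  | succ n ih =>
    rw [Finset.sum_Icc_succ_top (by omega), ← add_assoc, ih, exploreSize]
    have := exploreLevel_mono hb hG (k := n + 1) (k' := n + 1 + 1) (by omega) (by omega)
    omega

variable {b ω : ℝ} {G : ℕ} {X : ℕ → ℝ}

/-- Position of the exploration pulls of arm `j` within its block. -/
lemma ceil_div_eq_iff {m D a : ℕ} (hD : 0 < D) :
    a + 1 = ⌈(m : ℝ) / (D : ℝ)⌉₊ ↔ a * D < m ∧ m ≤ (a + 1) * D := by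
  have hD' : (0 : ℝ) < D := by exact_mod_cast hD
  rw [eq_comm, Nat.ceil_eq_iff (by omega), lt_div_iff₀ hD', div_le_iff₀ hD']
  simp only [Nat.add_sub_cancel]
  norm_cast

lemma block_sub_cast {t : ℕ} :
    (t : ℝ) - ((t / G : ℕ) : ℝ) * (G : ℝ) = ((t - t / G * G : ℕ) : ℝ) := by
  rw [Nat.cast_sub (Nat.div_mul_le_self t G)]
  push_cast
  ring

lemma IsExploration.exploreSize_pos {t : ℕ} (h : IsExploration K b G t) :
    0 < exploreSize b G (t / G) := by
  rcases Nat.eq_zero_or_pos (exploreSize b G (t / G)) with h0 | h0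
  · have := h.2.2
    have := h.2.1
    rw [h0] at *
    omega
  · exact h0

open Classical in
/-- The initialization and the pure exploration pull arm `j` at most
`exploreLevel b G (T / G + 1)` times up to round `T`. -/
lemma IsMedEUCB.card_forced_le (h : IsMedEUCB b ω G I X) (hb : 0 ≤ b) (hG : 1 ≤ G) (T : ℕ) :
    ((pullTimes I j T).filter fun t =>
      t ≤ K * exploreLevel b G 1 ∨ IsExploration K b G t).card ≤
      exploreLevel b G (T / G + 1) := by
  have hsub : ((pullTimes I j T).filter fun t =>
      t ≤ K * exploreLevel b G 1 ∨ IsExploration K b G t) ⊆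
      pullTimes I j (K * exploreLevel b G 1) ∪ (Finset.Icc 1 (T / G)).biUnion fun k =>
        Finset.Ioc (k * G + j * exploreSize b G k) (k * G + (j + 1) * exploreSize b G k) := by
    intro t ht
    simp only [pullTimes, Finset.mem_filter, Finset.mem_Icc, Finset.mem_union,
      Finset.mem_biUnion, Finset.mem_Ioc] at ht ⊢
    obtain ⟨⟨⟨ht1, htT⟩, hIt⟩, hc⟩ := ht
    by_cases hinit : t ≤ K * exploreLevel b G 1
    · exact Or.inl ⟨⟨ht1, hinit⟩, hIt⟩
    · have hex := hc.resolve_left hinit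
      refine Or.inr ⟨t / G, ⟨hex.1, Nat.div_le_div_right htT⟩, ?_⟩
      have he := h.explore t (by omega) hex
      rw [block_sub_cast, ceil_div_eq_iff hex.exploreSize_pos, hIt] at he
      have := Nat.div_mul_le_self t G
      omega
  calc _ ≤ _ := Finset.card_le_card hsub
    _ ≤ _ := Finset.card_union_le _ _
    _ ≤ exploreLevel b G 1 + ∑ k ∈ Finset.Icc 1 (T / G), exploreSize b G k := by
        refine add_le_add (h.init j).le (Finset.card_biUnion_le.trans
          (Finset.sum_le_sum fun k _ => ?_))
        rw [Nat.card_Ioc, add_mul]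
        omega
    _ = _ := exploreLevel_add_sum hb hG _

/-- A block in which the exploration fits raises the number of pulls by `exploreSize`. -/
lemma IsMedEUCB.numPulls_block (h : IsMedEUCB b ω G I X) {k : ℕ} (hk : 1 ≤ k)
    (hinit : K * exploreLevel b G 1 < k * G + 1) (hfit : K * exploreSize b G k < G) :
    numPulls I j (k * G - 1) + exploreSize b G k ≤ numPulls I j ((k + 1) * G - 1) := by
  classical
  set D := exploreSize b G k with hD
  have hjK : ((j : ℕ) + 1) * D ≤ K * D := Nat.mul_le_mul_right D j.2
  have hkG : (k + 1) * G = k * G + G := by ring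
  -- Exploration in block `k` starts after round `k * G`, and `hfit` ends it before round `(k + 1) *
  -- G`. The offset `- 1` makes the bound usable at `t - 1` for every `t` of the next block, its
  -- first round included.
  have hsub : pullTimes I j (k * G - 1) ∪ Finset.Ioc (k * G + j * D) (k * G + (j + 1) * D) ⊆
      pullTimes I j ((k + 1) * G - 1) := by
    refine Finset.union_subset (pullTimes_mono (by omega)) fun t ht => ?_
    rw [Finset.mem_Ioc] at ht
    have hdiv : t / G = k :=
      Nat.div_eq_of_lt_le (by omega) (by rw [hkG]; omega)
    have hDpos : 0 < D := by
      rcases Nat.eq_zero_or_pos D with h0 | h0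
      · rw [h0] at ht; omega
      · exact h0
    have hex : IsExploration K b G t := by
      unfold IsExploration
      rw [hdiv, ← hD]
      omega
    have he := h.explore t (by omega) hex
    rw [block_sub_cast, ceil_div_eq_iff hex.exploreSize_pos, hdiv, ← hD] at he
    simp only [pullTimes, Finset.mem_filter, Finset.mem_Icc]
    refine ⟨by omega, ?_⟩
    have h1 : (j : ℕ) < (I t : ℕ) + 1 := by
      by_contra! hle
      have := Nat.mul_le_mul_right D hle
      omega
    have h2 : (I t : ℕ) < (j : ℕ) + 1 := by
      by_contra! hle
      have := Nat.mul_le_mul_right D hle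
      omega
    exact Fin.ext (by omega)
  have hdisj : Disjoint (pullTimes I j (k * G - 1))
      (Finset.Ioc (k * G + j * D) (k * G + (j + 1) * D)) := by
    rw [Finset.disjoint_left]
    intro t ht ht'
    simp only [pullTimes, Finset.mem_filter, Finset.mem_Icc, Finset.mem_Ioc] at ht ht'
    omega
  have := Finset.card_le_card hsub
  rw [Finset.card_union_of_disjoint hdisj, Nat.card_Ioc, add_mul] at this
  unfold numPulls
  omega

end Counting

/-! ### Consequences of the parameter conditions -/

section Parameters

variable {K : ℕ} {b : ℝ} {G : ℕ}

lemma three_log_two_le_log_groupSize (hK : 2 ≤ K) (hb : 8 ≤ b) (hG : 2 ≤ G)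
    (hKG : (K : ℝ) * b * Real.log G ≤ G) : 3 * Real.log 2 ≤ Real.log G := by
  have hK' : (2 : ℝ) ≤ K := by exact_mod_cast hK
  have hG' : (2 : ℝ) ≤ G := by exact_mod_cast hG
  have hlog : Real.log 2 ≤ Real.log G := Real.log_le_log (by norm_num) hG'
  have h2 := Real.log_two_gt_d9
  have hKb : (16 : ℝ) ≤ K * b := by nlinarith
  have h8 : (8 : ℝ) ≤ G := by nlinarith
  calc 3 * Real.log 2 = Real.log (2 ^ 3) := by rw [Real.log_pow]; norm_num
    _ ≤ Real.log G := Real.log_le_log (by norm_num) (by linarith)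

lemma exploreLevel_lt (hb : 0 ≤ b) (hG : 1 ≤ G) {k : ℕ} (hk : 1 ≤ k) :
    (exploreLevel b G k : ℝ) < b * Real.log (k * G) + 1 := by
  refine Nat.ceil_lt_add_one (mul_nonneg hb (Real.log_nonneg ?_))
  exact_mod_cast Nat.one_le_iff_ne_zero.2 (Nat.mul_ne_zero (by omega) (by omega))

lemma log_succ_mul_le (hG : 1 ≤ G) {k : ℕ} (hk : 1 ≤ k) :
    Real.log (((k + 1 : ℕ) : ℝ) * G) ≤ Real.log (k * G) + Real.log 2 := by
  have hk' : (1 : ℝ) ≤ k := by exact_mod_cast hk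
  have hG' : (1 : ℝ) ≤ G := by exact_mod_cast hG
  rw [← Real.log_mul (by positivity) (by norm_num)]
  refine Real.log_le_log (by positivity) ?_
  push_cast
  nlinarith

lemma exploreLevel_succ_lt (hb : 0 ≤ b) (hG : 1 ≤ G) {k : ℕ} (hk : 1 ≤ k) :
    (exploreLevel b G (k + 1) : ℝ) < exploreLevel b G k + b * Real.log 2 + 1 := by
  have h1 := exploreLevel_lt hb hG (k := k + 1) (by omega)
  have h2 := mul_le_mul_of_nonneg_left (log_succ_mul_le hG hk) hb
  have h3 : b * Real.log (k * G) ≤ exploreLevel b G k := Nat.le_ceil _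
  linarith

lemma exploration_fits (hK : 2 ≤ K) (hb : 8 ≤ b) (hG : 2 ≤ G)
    (hKG : (K : ℝ) * b * Real.log G ≤ G) {k : ℕ} (hk : 1 ≤ k) : K * exploreSize b G k < G := by
  have hlog := three_log_two_le_log_groupSize hK hb hG hKG
  have h2 := Real.log_two_gt_d9
  have hK' : (2 : ℝ) ≤ K := by exact_mod_cast hK
  have hD : (exploreSize b G k : ℝ) < b * Real.log 2 + 1 := by
    rw [exploreSize,
      Nat.cast_sub (exploreLevel_mono (by linarith) (by omega) hk (Nat.le_succ k))]
    linarith [exploreLevel_succ_lt (b := b) (by linarith) (by omega : 1 ≤ G) hk]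
  have : (K : ℝ) * exploreSize b G k < G := by
    have h3 : b * Real.log 2 + 1 ≤ b * Real.log G := by nlinarith
    have h4 : (K : ℝ) * exploreSize b G k < K * (b * Real.log 2 + 1) := by gcongr
    have h5 : (K : ℝ) * (b * Real.log 2 + 1) ≤ K * (b * Real.log G) := by gcongr
    linarith
  exact_mod_cast this

lemma init_lt_two_mul (hK : 2 ≤ K) (hb : 8 ≤ b) (hG : 2 ≤ G)
    (hKG : (K : ℝ) * b * Real.log G ≤ G) : K * exploreLevel b G 1 < 2 * G := by
  have hlog := three_log_two_le_log_groupSize hK hb hG hKG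
  have h2 := Real.log_two_gt_d9
  have hK' : (2 : ℝ) ≤ K := by exact_mod_cast hK
  have hL := exploreLevel_lt (b := b) (by linarith) (by omega : 1 ≤ G) le_rfl
  rw [Nat.cast_one, one_mul] at hL
  have : (K : ℝ) * exploreLevel b G 1 < 2 * G := by
    have h3 : 1 ≤ b * Real.log G := by nlinarith
    have h4 : (K : ℝ) * exploreLevel b G 1 < K * (b * Real.log G + 1) := by gcongr
    have h5 : (K : ℝ) * 1 ≤ K * (b * Real.log G) := by gcongr
    linarith
  exact_mod_cast this

/-- Every arm has been pulled sufficiently often before each round after the initialization. -/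
lemma IsMedEUCB.le_numPulls {ω : ℝ} {I : ℕ → Fin K} {X : ℕ → ℝ} (h : IsMedEUCB b ω G I X)
    (hK : 2 ≤ K) (hb : 8 ≤ b) (hG : 2 ≤ G) (hKG : (K : ℝ) * b * Real.log G ≤ G) (j : Fin K)
    {t : ℕ} (ht : K * exploreLevel b G 1 < t) :
    b / 4 * Real.log t ≤ numPulls I j (t - 1) := by
  have hb0 : 0 ≤ b := by linarith
  have hlog := three_log_two_le_log_groupSize hK hb hG hKG
  have h2 := Real.log_two_gt_d9
  have h2' := Real.log_two_lt_d9
  have hinit := init_lt_two_mul hK hb hG hKG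
  have hfirst : exploreLevel b G 1 ≤ numPulls I j (t - 1) :=
    (h.init j).symm.le.trans (numPulls_mono (by omega))
  have hL1 : b * Real.log G ≤ exploreLevel b G 1 := by
    simpa [exploreLevel] using Nat.le_ceil (b * Real.log (((1 : ℕ) : ℝ) * (G : ℝ)))
  have hL2 := exploreLevel_succ_lt hb0 (by omega : 1 ≤ G) le_rfl
  -- The initialization may overrun block 1 and swallow its exploration, so counting starts at block
  -- 2. The possible loss, `exploreLevel b G 2 - exploreLevel b G 1 < b log 2 + 1`, is absorbed by
  -- the factor `1/4`.
  have hblocks : ∀ k, 2 ≤ k → exploreLevel b G k + exploreLevel b G 1 ≤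
      numPulls I j (k * G - 1) + exploreLevel b G 2 := by
    intro k hk
    induction k, hk using Nat.le_induction with
    | base =>
      have := (h.init j).symm.le.trans
        (numPulls_mono (I := I) (j := j) (by omega : K * exploreLevel b G 1 ≤ 2 * G - 1))
      omega
    | succ k hk ih =>
      have hkG : 2 * G ≤ k * G := Nat.mul_le_mul_right G hk
      have := h.numPulls_block (j := j) (by omega : 1 ≤ k) (by omega)
        (exploration_fits hK hb hG hKG (by omega))
      have := exploreLevel_mono hb0 (by omega : 1 ≤ G) (by omega : 1 ≤ k) (Nat.le_succ k)
      simp only [exploreSize, Nat.succ_eq_add_one] at *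
      omega
  have htpos : (0 : ℝ) < t := by exact_mod_cast (by omega : 0 < t)
  have htlt : t < (t / G + 1) * G := by
    have := Nat.lt_div_mul_add (a := t) (by omega : 0 < G)
    linarith
  have htlog : Real.log t ≤ Real.log (((t / G + 1 : ℕ) : ℝ) * G) :=
    Real.log_le_log htpos (by exact_mod_cast htlt.le)
  have hGlog : 0 ≤ Real.log G := by linarith
  rcases lt_or_ge (t / G) 2 with hk | hk
  · have hle : Real.log t ≤ Real.log (2 * G) := by
      refine Real.log_le_log htpos ?_
      have : t ≤ 2 * G := htlt.le.trans (Nat.mul_le_mul_right G (by omega))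
      exact_mod_cast this
    rw [Real.log_mul (by norm_num) (by positivity)] at hle
    have hfirst' : (exploreLevel b G 1 : ℝ) ≤ numPulls I j (t - 1) := by exact_mod_cast hfirst
    nlinarith
  · have h3 := log_succ_mul_le (by omega : 1 ≤ G) (by omega : 1 ≤ t / G)
    have h4 : b * Real.log ((t / G : ℕ) * G) ≤ exploreLevel b G (t / G) := Nat.le_ceil _
    have h5 := hblocks _ hk
    have h6 : numPulls I j (t / G * G - 1) ≤ numPulls I j (t - 1) :=
      numPulls_mono (Nat.sub_le_sub_right (Nat.div_mul_le_self t G) 1)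
    have h7 : (exploreLevel b G (t / G) : ℝ) + exploreLevel b G 1 ≤
        numPulls I j (t - 1) + exploreLevel b G 2 := by exact_mod_cast h5.trans (by omega)
    have h8 : Real.log G ≤ Real.log ((t / G : ℕ) * G) := by
      have hk' : (1 : ℝ) ≤ (t / G : ℕ) := by exact_mod_cast (by omega : 1 ≤ t / G)
      refine Real.log_le_log (by positivity) ?_
      nlinarith [(by positivity : (0 : ℝ) ≤ G)]
    norm_num at hL2
    set A := Real.log ((t / G : ℕ) * G)
    have h9 : b / 4 * Real.log t ≤ b / 4 * (A + Real.log 2) := by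
      gcongr
      linarith
    nlinarith

end Parameters

/-! ### Concentration of hits under adaptive sampling -/

namespace AttackedBandit

variable {K : ℕ} {ν : Fin K → Measure ℝ} {ρ : ℝ} {Ω : Type*} [mΩ : MeasurableSpace Ω]
  {P : Measure Ω}

open Classical in
/-- Pulls of arm `j` up to round `t` whose clean reward lies in `S` or that are attacked. -/
noncomputable def hits (B : AttackedBandit ν ρ P) (j : Fin K) (S : Set ℝ) (t : ℕ) (w : Ω) :
    Finset ℕ :=
  (pullTimes (fun τ => B.arm τ w) j t).filter
    fun τ => B.clean j τ w ∈ S ∨ B.attacks τ w = true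

/-- The event that the hits make up at least half of exactly `n` pulls of arm `j`. -/
def manyHits (B : AttackedBandit ν ρ P) (j : Fin K) (S : Set ℝ) (t n : ℕ) : Set Ω :=
  {w | numPulls (fun τ => B.arm τ w) j t = n ∧ n ≤ 2 * (B.hits j S t w).card}

open Classical in
/-- Exponential supermartingale that controls the number of hits. -/
noncomputable def weight (B : AttackedBandit ν ρ P) (j : Fin K) (S : Set ℝ) (u q : ℝ) (t : ℕ)
    (w : Ω) : ℝ :=
  ∏ τ ∈ Finset.Icc 1 t, if B.arm τ w = j then
    (if B.clean j τ w ∈ S ∨ B.attacks τ w = true then u else u⁻¹) / q else 1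

variable (B : AttackedBandit ν ρ P) (j : Fin K) {S : Set ℝ} {u q : ℝ}

lemma weight_nonneg (hu : 0 ≤ u) (hq : 0 ≤ q) (t : ℕ) (w : Ω) : 0 ≤ B.weight j S u q t w := by
  refine Finset.prod_nonneg fun τ _ => ?_
  split_ifs <;> positivity

lemma weight_le (hu : 1 ≤ u) (hq : 0 < q) (hq1 : q ≤ 1) (t : ℕ) (w : Ω) :
    B.weight j S u q t w ≤ (u / q) ^ t := by
  have h1 : 1 ≤ u / q := by rw [le_div_iff₀ hq]; linarith
  have h2 : u⁻¹ ≤ u := (inv_le_one_of_one_le₀ hu).trans hu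
  calc B.weight j S u q t w ≤ ∏ τ ∈ Finset.Icc 1 t, u / q := by
        refine Finset.prod_le_prod (fun τ _ => ?_) fun τ _ => ?_
        · split_ifs <;> positivity
        · split_ifs
          · exact le_rfl
          · gcongr
          · exact h1
    _ = (u / q) ^ t := by rw [Finset.prod_const, Nat.card_Icc, Nat.add_sub_cancel]

lemma measurable_weight (hS : MeasurableSet S) (t : ℕ) :
    Measurable[B.ℱ t] (B.weight j S u q t) := by
  refine Finset.measurable_prod _ fun τ hτ => ?_
  obtain ⟨hτ1, hτt⟩ := Finset.mem_Icc.1 hτ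
  obtain ⟨σ, rfl⟩ : ∃ σ, τ = σ + 1 := ⟨τ - 1, by omega⟩
  have harm : MeasurableSet[B.ℱ t] {w | B.arm (σ + 1) w = j} :=
    B.ℱ.mono (by omega : σ ≤ t) _ (B.measurable_arm σ (measurableSet_singleton j))
  have hcl : MeasurableSet[B.ℱ t] {w | B.clean j (σ + 1) w ∈ S} :=
    B.ℱ.mono hτt _ (B.measurable_clean j σ hS)
  have hat : MeasurableSet[B.ℱ t] {w | B.attacks (σ + 1) w = true} :=
    B.ℱ.mono hτt _ (B.measurable_attacks σ (measurableSet_singleton true))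
  exact Measurable.ite harm ((Measurable.ite (hcl.union hat) measurable_const
    measurable_const).div_const q) measurable_const

lemma integrable_weight [IsProbabilityMeasure P] (hS : MeasurableSet S) (hu : 1 ≤ u) (hq : 0 < q)
    (hq1 : q ≤ 1) (t : ℕ) : Integrable (B.weight j S u q t) P := by
  refine Integrable.of_bound
    ((B.measurable_weight j hS t).mono (B.ℱ.le t) le_rfl).aestronglyMeasurable ((u / q) ^ t)
    (Filter.Eventually.of_forall fun w => ?_)
  rw [Real.norm_of_nonneg (B.weight_nonneg j (by linarith) hq.le t w)]
  exact B.weight_le j hu hq hq1 t w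

lemma setIntegral_of_indep [IsProbabilityMeasure P] {m m' : MeasurableSpace Ω} (hm : m ≤ mΩ)
    (hm' : m' ≤ mΩ) (h : Indep m m' P) {A : Set Ω} (hA : MeasurableSet[m] A) {g : Ω → ℝ}
    (hg : Measurable[m'] g) : ∫ w in A, g w ∂P = P.real A * ∫ w, g w ∂P :=
  Indep.setIntegral_eq_mul (X := g) (f := id) hm
    (indep_of_indep_of_le_right h hg.comap_le)
    (hg.mono hm' le_rfl).aemeasurable hA measurable_id.aestronglyMeasurable

/-- The next arm is determined by the past, while the clean reward and the attack are each
independent of it. On a pull of `j` the conditional mean of the new factor is therefore at most the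
left side of `huq` divided by `q`, hence at most 1. -/
lemma integral_weight_le_one [IsProbabilityMeasure P] (hS : MeasurableSet S) (hu : 1 ≤ u)
    (hq : 0 < q) (hq1 : q ≤ 1) (huq : u⁻¹ + (u - u⁻¹) * ((ν j).real S + ρ) ≤ q) (t : ℕ) :
    ∫ w, B.weight j S u q t w ∂P ≤ 1 := by
  classical
  induction t with
  | zero => simp [weight]
  | succ t ih =>
    set M := B.weight j S u q t with hM
    set J : Set Ω := {w | B.arm (t + 1) w = j} with hJ
    set C : Set Ω := {w | B.clean j (t + 1) w ∈ S} with hC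
    set A : Set Ω := {w | B.attacks (t + 1) w = true} with hA
    have hle := B.ℱ.le
    have hJm : MeasurableSet[B.ℱ t] J := B.measurable_arm t (measurableSet_singleton j)
    have hJm' : MeasurableSet J := hle t _ hJm
    have hcm : Measurable (B.clean j (t + 1)) := (B.measurable_clean j t).mono (hle _) le_rfl
    have ham : Measurable (B.attacks (t + 1)) := (B.measurable_attacks t).mono (hle _) le_rfl
    have hCm : MeasurableSet C := hcm hS
    have hAm : MeasurableSet A := ham (measurableSet_singleton true)
    have hMm : Measurable[B.ℱ t] M := B.measurable_weight j hS t
    have hMi : Integrable M P := B.integrable_weight j hS hu hq hq1 t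
    set g := J.indicator M with hg
    have hgm : Measurable[B.ℱ t] g := hMm.indicator hJm
    have hgi : Integrable g P := hMi.indicator hJm'
    have hM0 : ∀ w, 0 ≤ M w := B.weight_nonneg j (by linarith) hq.le t
    have hg0 : ∀ w, 0 ≤ g w := fun w => Set.indicator_nonneg (fun w _ => hM0 w) w
    have hPC : P.real C = (ν j).real S := by
      rw [← B.law_clean j t, map_measureReal_apply hcm hS]
      rfl
    have hPA : P.real A = ρ := B.prob_attacks t
    have hcC : ∫ w, C.indicator g w ∂P = (ν j).real S * ∫ w, g w ∂P := by
      rw [integral_indicator hCm, ← hPC]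
      exact setIntegral_of_indep hcm.comap_le (hle t) (B.indep_clean j t) ⟨S, hS, rfl⟩ hgm
    have hcA : ∫ w, A.indicator g w ∂P = ρ * ∫ w, g w ∂P := by
      rw [integral_indicator hAm, ← hPA]
      exact setIntegral_of_indep ham.comap_le (hle t) (B.indep_attacks t)
        ⟨{true}, measurableSet_singleton true, rfl⟩ hgm
    have hu0 : 0 ≤ u - u⁻¹ := sub_nonneg.2 ((inv_le_one_of_one_le₀ hu).trans hu)
    -- The indicator of `C ∪ A` is bounded by the sum of the two indicators, so no independence
    -- between reward and attack within the round is needed.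
    have hstep : ∀ w, B.weight j S u q (t + 1) w ≤ Jᶜ.indicator M w +
        (u⁻¹ / q * g w + (u - u⁻¹) / q * (C.indicator g w + A.indicator g w)) := by
      intro w
      have hsucc : B.weight j S u q (t + 1) w = M w * (if w ∈ J then
          (if w ∈ C ∨ w ∈ A then u else u⁻¹) / q else 1) := by
        rw [weight, Finset.prod_Icc_succ_top (by omega)]
        congr
      rw [hsucc]
      by_cases hw : w ∈ J
      · have h2 : Jᶜ.indicator M w = 0 := Set.indicator_of_notMem (by simpa using hw) _
        have h3 : g w = M w := Set.indicator_of_mem hw _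
        rw [if_pos hw, h2, zero_add]
        have hM0' := hM0 w
        have hk : ∀ x : ℝ, 1 ≤ x → M w * (u / q) ≤ u⁻¹ / q * M w + (u - u⁻¹) / q * (x * M w) := by
          intro x hx
          have : 0 ≤ (u - u⁻¹) / q * ((x - 1) * M w) :=
            mul_nonneg (div_nonneg hu0 hq.le) (mul_nonneg (by linarith) hM0')
          have h5 : u⁻¹ / q * M w + (u - u⁻¹) / q * (x * M w) - M w * (u / q) =
            (u - u⁻¹) / q * ((x - 1) * M w) := by ring
          linarith
        by_cases hc : w ∈ C <;> by_cases ha : w ∈ A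
        · rw [Set.indicator_of_mem hc, Set.indicator_of_mem ha, h3, if_pos (Or.inl hc)]
          have := hk 2 (by norm_num)
          rwa [two_mul] at this
        · rw [Set.indicator_of_mem hc, Set.indicator_of_notMem ha, h3, if_pos (Or.inl hc)]
          simpa using hk 1 le_rfl
        · rw [Set.indicator_of_notMem hc, Set.indicator_of_mem ha, h3, if_pos (Or.inr ha)]
          simpa using hk 1 le_rfl
        · rw [Set.indicator_of_notMem hc, Set.indicator_of_notMem ha, h3,
            if_neg (not_or.2 ⟨hc, ha⟩)]
          simp [mul_comm]
      · have h2 : Jᶜ.indicator M w = M w := Set.indicator_of_mem hw _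
        have h3 : g w = 0 := Set.indicator_of_notMem hw _
        have h4 : C.indicator g w = 0 := Set.indicator_apply_eq_zero.2 fun _ => h3
        have h5 : A.indicator g w = 0 := Set.indicator_apply_eq_zero.2 fun _ => h3
        rw [if_neg hw, h2, h3, h4, h5]
        simp
    have hiJ : Integrable (Jᶜ.indicator M) P := hMi.indicator hJm'.compl
    have hiC : Integrable (C.indicator g) P := hgi.indicator hCm
    have hiA : Integrable (A.indicator g) P := hgi.indicator hAm
    have hi1 : Integrable (fun w => u⁻¹ / q * g w) P := hgi.const_mul _
    have hi2 : Integrable (fun w => (u - u⁻¹) / q * (C.indicator g w + A.indicator g w)) P :=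
      (hiC.add hiA).const_mul _
    have hi3 : Integrable (fun w => u⁻¹ / q * g w +
      (u - u⁻¹) / q * (C.indicator g w + A.indicator g w)) P := hi1.add hi2
    calc ∫ w, B.weight j S u q (t + 1) w ∂P
        ≤ ∫ w, (Jᶜ.indicator M w +
          (u⁻¹ / q * g w + (u - u⁻¹) / q * (C.indicator g w + A.indicator g w))) ∂P :=
          integral_mono (B.integrable_weight j hS hu hq hq1 (t + 1))
            (hiJ.add hi3) hstep
      _ = ∫ w, Jᶜ.indicator M w ∂P + (u⁻¹ / q * ∫ w, g w ∂P + (u - u⁻¹) / q *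
          ((ν j).real S * ∫ w, g w ∂P + ρ * ∫ w, g w ∂P)) := by
          rw [integral_add hiJ hi3, integral_add hi1 hi2, integral_const_mul,
            integral_const_mul, integral_add hiC hiA, hcC, hcA]
      _ = ∫ w, Jᶜ.indicator M w ∂P +
          (u⁻¹ + (u - u⁻¹) * ((ν j).real S + ρ)) / q * ∫ w, g w ∂P := by ring
      _ ≤ ∫ w, Jᶜ.indicator M w ∂P + 1 * ∫ w, g w ∂P := by
          have : 0 ≤ ∫ w, g w ∂P := integral_nonneg hg0
          gcongr
          rwa [div_le_one hq]
      _ = ∫ w, M w ∂P := by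
          rw [one_mul, ← integral_add hiJ hgi]
          congr 1 with w
          exact congrFun (Set.indicator_compl_add_self J M) w
      _ ≤ 1 := ih

/-- Hits are at least as many as the other pulls, so the powers of `u` multiply to at least 1 and
only `q⁻ⁿ` remains. -/
lemma inv_pow_le_weight (hu : 1 ≤ u) (hq : 0 < q) {t n : ℕ} {w : Ω} (hw : w ∈ B.manyHits j S t n) :
    (q ^ n)⁻¹ ≤ B.weight j S u q t w := by
  classical
  obtain ⟨hn, hhits⟩ := hw
  have hcard := Finset.card_filter_add_card_filter_not (s := pullTimes (fun τ => B.arm τ w) j t)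
    (fun τ => B.clean j τ w ∈ S ∨ B.attacks τ w = true)
  have hpull : (pullTimes (fun τ => B.arm τ w) j t).card = n := hn
  rw [weight, ← Finset.prod_filter]
  change _ ≤ ∏ τ ∈ pullTimes (fun τ => B.arm τ w) j t, _
  rw [Finset.prod_div_distrib, Finset.prod_const, hpull, Finset.prod_ite, Finset.prod_const,
    Finset.prod_const, inv_eq_one_div]
  unfold hits at hhits
  gcongr
  rw [inv_pow, ← div_eq_mul_inv, one_le_div (by positivity)]
  exact pow_le_pow_right₀ hu (by omega)

/-- Concentration of the number of hits. -/
lemma measureReal_manyHits_le [IsProbabilityMeasure P] [IsProbabilityMeasure (ν j)]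
    (hS : MeasurableSet S) {δ : ℝ} (hδ : 0 ≤ δ) (hρ : 0 ≤ ρ)
    (hSδ : (ν j).real S + ρ ≤ 1 / 2 - δ) (t n : ℕ) :
    P.real (B.manyHits j S t n) ≤ Real.exp (-(2 * δ ^ 2 * n)) := by
  have hν : 0 ≤ (ν j).real S := measureReal_nonneg
  have hδ' : δ ≤ 1 / 2 := by linarith
  -- This near-optimal tilt makes `u⁻¹ + (u - u⁻¹) (1/2 - δ)` exactly equal to `1 - 2 δ²`.
  set u : ℝ := 1 + 2 * δ with hu_def
  set q : ℝ := 1 - 2 * δ ^ 2 with hq_def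
  have hu : 1 ≤ u := by linarith
  have hq : 0 < q := by nlinarith
  have hq1 : q ≤ 1 := by nlinarith
  have hu0 : 0 ≤ u - u⁻¹ := sub_nonneg.2 ((inv_le_one_of_one_le₀ hu).trans hu)
  have huq : u⁻¹ + (u - u⁻¹) * ((ν j).real S + ρ) ≤ q := by
    calc u⁻¹ + (u - u⁻¹) * ((ν j).real S + ρ) ≤ u⁻¹ + (u - u⁻¹) * (1 / 2 - δ) := by gcongr
      _ = q := by
        have : u ≠ 0 := by positivity
        field_simp
        rw [hu_def, hq_def]
        ring
  have hmarkov := mul_meas_ge_le_integral_of_nonneg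
    (Filter.Eventually.of_forall (B.weight_nonneg j (S := S) (by linarith) hq.le t))
    (B.integrable_weight j hS hu hq hq1 t) ((q ^ n)⁻¹)
  have hone := B.integral_weight_le_one j hS hu hq hq1 huq t
  calc P.real (B.manyHits j S t n) ≤ P.real {w | (q ^ n)⁻¹ ≤ B.weight j S u q t w} :=
        measureReal_mono fun w hw => B.inv_pow_le_weight j hu hq hw
    _ ≤ q ^ n := by
        have h := hmarkov.trans hone
        rwa [inv_mul_le_iff₀ (by positivity), mul_one] at h
    _ ≤ Real.exp (-(2 * δ ^ 2)) ^ n := by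
        gcongr
        linarith [Real.add_one_le_exp (-(2 * δ ^ 2))]
    _ = Real.exp (-(2 * δ ^ 2 * n)) := by
        rw [← Real.exp_nat_mul]
        ring_nf

/-- Union bound over the number of pulls. -/
lemma measureReal_exists_manyHits_le [IsProbabilityMeasure P] [IsProbabilityMeasure (ν j)]
    (hρ : 0 ≤ ρ) {c : ℝ} (hc : 0 < c) {t : ℕ} (ht : 1 ≤ t) {S : ℕ → Set ℝ} {δ : ℕ → ℝ}
    (hS : ∀ n, MeasurableSet (S n)) (hδ : ∀ n, 0 ≤ δ n)
    (hSδ : ∀ n, 0 < n → (ν j).real (S n) + ρ ≤ 1 / 2 - δ n)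
    (hexp : ∀ n : ℕ, 0 < n → c * Real.log t ≤ n → 2 * Real.log t ≤ δ n ^ 2 * n) :
    P.real {w | c * Real.log t ≤ numPulls (fun τ => B.arm τ w) j (t - 1) ∧
      w ∈ B.manyHits j (S (numPulls (fun τ => B.arm τ w) j (t - 1))) (t - 1)
        (numPulls (fun τ => B.arm τ w) j (t - 1))} ≤ 1 / (t : ℝ) ^ 2 := by
  classical
  -- For `t = 1` the bound is 1 and trivial; otherwise `log t > 0` excludes `n = 0`.
  rcases Nat.eq_or_lt_of_le ht with rfl | ht2
  · simp
  have htpos : (0 : ℝ) < t := by positivity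
  have hlog : 0 < Real.log t := Real.log_pos (by exact_mod_cast ht2)
  set R : Finset ℕ := (Finset.range t).filter fun n => 0 < n ∧ c * Real.log t ≤ n with hR
  calc _ ≤ P.real (⋃ n ∈ R, B.manyHits j (S n) (t - 1) n) := by
        refine measureReal_mono (fun w hw => ?_) (measure_ne_top _ _)
        obtain ⟨h1, h2⟩ := hw
        simp only [Set.mem_iUnion, exists_prop]
        refine ⟨_, ?_, h2⟩
        rw [hR, Finset.mem_filter, Finset.mem_range]
        refine ⟨(numPulls_le _).trans_lt (by omega), ?_, h1⟩
        exact_mod_cast (mul_pos hc hlog).trans_le h1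
    _ ≤ ∑ n ∈ R, P.real (B.manyHits j (S n) (t - 1) n) := measureReal_biUnion_finset_le _ _
    _ ≤ ∑ n ∈ R, 1 / (t : ℝ) ^ 4 := by
        refine Finset.sum_le_sum fun n hn => ?_
        obtain ⟨-, hn0, hn⟩ := Finset.mem_filter.1 hn
        refine (B.measureReal_manyHits_le j (hS n) (hδ n) hρ (hSδ n hn0) _ _).trans ?_
        calc Real.exp (-(2 * δ n ^ 2 * n)) ≤ Real.exp (-((4 : ℕ) * Real.log t)) := by
              refine Real.exp_le_exp.2 (neg_le_neg ?_)
              push_cast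
              linarith [hexp n hn0 hn]
          _ = 1 / (t : ℝ) ^ 4 := by
              rw [Real.exp_neg, Real.exp_nat_mul, Real.exp_log htpos, one_div]
    _ ≤ t * (1 / (t : ℝ) ^ 4) := by
        rw [Finset.sum_const, nsmul_eq_mul]
        gcongr
        exact_mod_cast (Finset.card_filter_le _ _).trans (Finset.card_range t).le
    _ = 1 / (t : ℝ) ^ 3 := by field_simp
    _ ≤ 1 / (t : ℝ) ^ 2 := by
        gcongr
        · exact_mod_cast ht
        · norm_num

end AttackedBandit

/-! ### Numerical estimates -/

/-- The confidence radius is large enough for the concentration bound. -/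
lemma two_log_le_sq_mul {s ρ l ξ b ω L n : ℝ} (hρ : ρ < s) (hl : 0 < l) (hξ : 0 < ξ)
    (hb1 : ω / ξ ^ 2 ≤ b) (hb2 : 2 / (s - ρ) ^ 2 ≤ b) (hω : 2 / l ^ 2 ≤ ω) (hL : 0 ≤ L)
    (hn : 0 < n) (hLn : b / 4 * L ≤ n) :
    2 * L ≤ (s - ρ + l * min (Real.sqrt (ω * L / n)) ξ) ^ 2 * n := by
  have hω0 : 0 < ω := (by positivity : 0 < 2 / l ^ 2).trans_le hω
  have hsρ : 0 < s - ρ := sub_pos.2 hρ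
  have hωl : 2 ≤ ω * l ^ 2 := by rwa [div_le_iff₀ (by positivity)] at hω
  rcases le_total (Real.sqrt (ω * L / n)) ξ with h | h
  · rw [min_eq_left h]
    calc 2 * L ≤ (ω * l ^ 2) * L := by gcongr
      _ = (l * Real.sqrt (ω * L / n)) ^ 2 * n := by
        rw [mul_pow, Real.sq_sqrt (by positivity)]
        field_simp
      _ ≤ _ := by
        gcongr
        linarith
  · rw [min_eq_right h]
    have h1 : 2 ≤ b * (s - ρ) ^ 2 := by rwa [div_le_iff₀ (by positivity)] at hb2
    have h2 : ω ≤ b * ξ ^ 2 := by rwa [div_le_iff₀ (by positivity)] at hb1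
    have h3 : 2 ≤ b * (l * ξ) ^ 2 := by nlinarith [sq_nonneg l]
    have hb : 0 < b := (by positivity : 0 < 2 / (s - ρ) ^ 2).trans_le hb2
    have hc : 0 < l * ξ := by positivity
    -- The cross term is the geometric mean of the two squares, each at least 2. Expanding the
    -- square gives `2 + 2 * 2 + 2 = 8`, which cancels the `1/4` in `hLn`.
    have h4 : 2 ≤ b * ((s - ρ) * (l * ξ)) := by
      refine le_of_sq_le_sq ?_ (by positivity)
      calc (2 : ℝ) ^ 2 = 2 * 2 := by norm_num
        _ ≤ (b * (s - ρ) ^ 2) * (b * (l * ξ) ^ 2) := by gcongr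
        _ = _ := by ring
    have h5 : 8 ≤ b * (s - ρ + l * ξ) ^ 2 := by nlinarith
    calc 2 * L ≤ b * (s - ρ + l * ξ) ^ 2 / 4 * L := by
          gcongr
          linarith
      _ = (s - ρ + l * ξ) ^ 2 * (b / 4 * L) := by ring
      _ ≤ _ := by gcongr

lemma sum_one_div_sq_le (T : ℕ) :
    ∑ t ∈ Finset.Icc 1 T, 1 / (t : ℝ) ^ 2 ≤ Real.pi ^ 2 / 6 :=
  sum_le_hasSum _ (fun _ _ => by positivity) hasSum_zeta_two

/-- The block in progress at round `T` ends by `T + G ≤ 2 * T`, whence `log (2 * T)` in the theorem.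
-/
lemma exploreLevel_last_le {b : ℝ} (hb : 0 ≤ b) {G T : ℕ} (hG : 1 ≤ G) (hGT : G ≤ T) :
    (exploreLevel b G (T / G + 1) : ℝ) ≤ b * Real.log (2 * T) + 1 := by
  refine (exploreLevel_lt hb hG (Nat.le_add_left 1 _)).le.trans ?_
  have h1 : (T / G + 1) * G ≤ 2 * T := by
    have := Nat.div_mul_le_self T G
    rw [add_mul]
    omega
  have h2 : 0 < (T / G + 1) * G := by positivity
  have h3 : Real.log (((T / G + 1 : ℕ) : ℝ) * G) ≤ Real.log (2 * T) :=
    Real.log_le_log (by exact_mod_cast h2) (by exact_mod_cast h1)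
  gcongr

/-! ### Misleading samples, pull counts and regret -/

namespace AttackedBandit

variable {K : ℕ} {ν : Fin K → Measure ℝ} {ρ : ℝ} {Ω : Type*} [mΩ : MeasurableSpace Ω]
  {P : Measure Ω} (B : AttackedBandit ν ρ P)

/-- Abbreviation for the number of pulls of arm `j` up to round `t`. -/
def pulls (j : Fin K) (t : ℕ) (w : Ω) : ℕ := numPulls (fun τ => B.arm τ w) j t

/-- An observation above `y` is either attacked or a clean reward above `y`, hence a hit; the size
of the attack never enters. -/
lemma median_le_of_notMem_manyHits {j : Fin K} {t : ℕ} {w : Ω} {y : ℝ}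
    (hpos : 0 < B.pulls j t w) (h : w ∉ B.manyHits j (Set.Ioi y) t (B.pulls j t w)) :
    sampleMedian (fun τ => B.arm τ w) (fun τ => B.observed τ w) j t ≤ y := by
  classical
  set Q := pullTimes (fun τ => B.arm τ w) j t with hQ
  have hcard : Q.card = B.pulls j t w := rfl
  have hlt : 2 * (B.hits j (Set.Ioi y) t w).card < Q.card := by
    by_contra! hle
    exact h ⟨rfl, hle⟩
  refine median_le (Q := Q) (Finset.card_pos.1 hpos) ?_
  have hsub : (Q.filter fun τ => ¬ B.observed τ w ≤ y) ⊆ B.hits j (Set.Ioi y) t w := by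
    intro τ hτ
    obtain ⟨hτQ, hτy⟩ := Finset.mem_filter.1 hτ
    refine Finset.mem_filter.2 ⟨hτQ, ?_⟩
    have harm : B.arm τ w = j := (Finset.mem_filter.1 hτQ).2
    by_cases ha : B.attacks τ w = true
    · exact Or.inr ha
    · left
      simpa [observed, ha, harm] using hτy
  have h1 := Finset.card_le_card hsub
  have h2 := Finset.card_filter_add_card_filter_not (s := Q) (fun τ => B.observed τ w ≤ y)
  omega

lemma le_median_of_notMem_manyHits {j : Fin K} {t : ℕ} {w : Ω} {y : ℝ}
    (hpos : 0 < B.pulls j t w) (h : w ∉ B.manyHits j (Set.Iic y) t (B.pulls j t w)) :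
    y ≤ sampleMedian (fun τ => B.arm τ w) (fun τ => B.observed τ w) j t := by
  classical
  set Q := pullTimes (fun τ => B.arm τ w) j t with hQ
  have hlt : 2 * (B.hits j (Set.Iic y) t w).card < Q.card := by
    by_contra! hle
    exact h ⟨rfl, hle⟩
  refine le_median (Q := Q) (Finset.card_pos.1 hpos) ?_
  have hsub : (Q.filter fun τ => B.observed τ w ≤ y) ⊆ B.hits j (Set.Iic y) t w := by
    intro τ hτ
    obtain ⟨hτQ, hτy⟩ := Finset.mem_filter.1 hτ
    refine Finset.mem_filter.2 ⟨hτQ, ?_⟩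
    have harm : B.arm τ w = j := (Finset.mem_filter.1 hτQ).2
    by_cases ha : B.attacks τ w = true
    · exact Or.inr ha
    · left
      simpa [observed, ha, harm] using hτy
  have h1 := Finset.card_le_card hsub
  omega

/-- The event that the samples mislead the upper confidence index of a suboptimal arm upwards. -/
def overestimate (B : AttackedBandit ν ρ P) (c ω θ : ℝ) (j : Fin K) (t : ℕ) : Set Ω :=
  {w | c * Real.log t ≤ B.pulls j (t - 1) w ∧
    w ∈ B.manyHits j (Set.Ioi (θ + Real.sqrt (ω * Real.log t / (B.pulls j (t - 1) w : ℝ))))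
      (t - 1) (B.pulls j (t - 1) w)}

/-- The event that the samples mislead the upper confidence index of the optimal arm downwards. -/
def underestimate (B : AttackedBandit ν ρ P) (c ω θ : ℝ) (j : Fin K) (t : ℕ) : Set Ω :=
  {w | c * Real.log t ≤ B.pulls j (t - 1) w ∧
    w ∈ B.manyHits j (Set.Iic (θ - Real.sqrt (ω * Real.log t / (B.pulls j (t - 1) w : ℝ))))
      (t - 1) (B.pulls j (t - 1) w)}

section Estimates

variable [IsProbabilityMeasure P] [∀ i, IsProbabilityMeasure (ν i)] {istar : Fin K}
  {s l ξ b ω : ℝ}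

lemma measureReal_overestimate_le (hgap : QuantileGap ν istar s l ξ) (hρ0 : 0 ≤ ρ) (hρ : ρ < s)
    (hb1 : ω / ξ ^ 2 ≤ b) (hb2 : 2 / (s - ρ) ^ 2 ≤ b) (hω : 2 / l ^ 2 ≤ ω) {j : Fin K}
    (hj : j ≠ istar) {t : ℕ} (ht : 1 ≤ t) :
    P.real (B.overestimate (b / 4) ω (quantile (cdf (ν j)) (1 / 2 + s)) j t) ≤
      1 / (t : ℝ) ^ 2 := by
  have hl := hgap.l_pos
  have hξ := hgap.ξ_pos
  have hsρ : 0 < s - ρ := sub_pos.2 hρ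
  have hb : 0 < b := (by positivity : 0 < 2 / (s - ρ) ^ 2).trans_le hb2
  have hlog : 0 ≤ Real.log t := Real.log_natCast_nonneg t
  set θ := quantile (cdf (ν j)) (1 / 2 + s)
  refine B.measureReal_exists_manyHits_le j hρ0 (by positivity : 0 < b / 4) ht
    (S := fun n => Set.Ioi (θ + Real.sqrt (ω * Real.log t / n)))
    (δ := fun n => s - ρ + l * min (Real.sqrt (ω * Real.log t / n)) ξ)
    (fun n => measurableSet_Ioi) (fun n => by positivity) (fun n hn => ?_) (fun n hn hLn => ?_)
  -- The density bound reaches only to distance `ξ`; beyond that the tail is bounded by its value at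
  -- `ξ`.
  · have h1 := hgap.tail_subopt hj (le_min (Real.sqrt_nonneg (ω * Real.log t / n)) hξ.le)
      (min_le_right _ _)
    have h2 : (ν j).real (Set.Ioi (θ + Real.sqrt (ω * Real.log t / n))) ≤
        (ν j).real (Set.Ioi (θ + min (Real.sqrt (ω * Real.log t / n)) ξ)) :=
      measureReal_mono (Set.Ioi_subset_Ioi (by gcongr; exact min_le_left _ _))
    linarith
  · exact two_log_le_sq_mul hρ hl hξ hb1 hb2 hω hlog (by exact_mod_cast hn) hLn

lemma measureReal_underestimate_le (hgap : QuantileGap ν istar s l ξ) (hρ0 : 0 ≤ ρ) (hρ : ρ < s)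
    (hb1 : ω / ξ ^ 2 ≤ b) (hb2 : 2 / (s - ρ) ^ 2 ≤ b) (hω : 2 / l ^ 2 ≤ ω) {t : ℕ}
    (ht : 1 ≤ t) :
    P.real (B.underestimate (b / 4) ω (quantile (cdf (ν istar)) (1 / 2 - s)) istar t) ≤
      1 / (t : ℝ) ^ 2 := by
  have hl := hgap.l_pos
  have hξ := hgap.ξ_pos
  have hsρ : 0 < s - ρ := sub_pos.2 hρ
  have hb : 0 < b := (by positivity : 0 < 2 / (s - ρ) ^ 2).trans_le hb2
  have hlog : 0 ≤ Real.log t := Real.log_natCast_nonneg t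
  set θ := quantile (cdf (ν istar)) (1 / 2 - s)
  refine B.measureReal_exists_manyHits_le istar hρ0 (by positivity : 0 < b / 4) ht
    (S := fun n => Set.Iic (θ - Real.sqrt (ω * Real.log t / n)))
    (δ := fun n => s - ρ + l * min (Real.sqrt (ω * Real.log t / n)) ξ)
    (fun n => measurableSet_Iic) (fun n => by positivity) (fun n hn => ?_) (fun n hn hLn => ?_)
  · have h1 := hgap.tail_opt (le_min (Real.sqrt_nonneg (ω * Real.log t / n)) hξ.le)
      (min_le_right _ _)
    have h2 : (ν istar).real (Set.Iic (θ - Real.sqrt (ω * Real.log t / n))) ≤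
        (ν istar).real (Set.Iic (θ - min (Real.sqrt (ω * Real.log t / n)) ξ)) :=
      measureReal_mono (Set.Iic_subset_Iic.2 (by gcongr; exact min_le_left _ _))
    linarith
  · exact two_log_le_sq_mul hρ hl hξ hb1 hb2 hω hlog (by exact_mod_cast hn) hLn

end Estimates

/-- A suboptimal arm that was pulled often is pulled again only after a misleading sample. -/
lemma mem_estimate_of_pull {b c ω : ℝ} {G : ℕ} {w : Ω} {j istar : Fin K} {θ θ' : ℝ}
    (h : IsMedEUCB b ω G (fun t => B.arm t w) (fun t => B.observed t w)) (hω : 0 ≤ ω)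
    (hc : 0 < c) (hθ : θ < θ') {t T : ℕ} (ht : K * exploreLevel b G 1 < t) (ht2 : 2 ≤ t)
    (htT : t ≤ T) (hex : ¬ IsExploration K b G t) (harm : B.arm t w = j)
    (hn : ∀ i, c * Real.log t ≤ B.pulls i (t - 1) w)
    (hlarge : 4 * ω * Real.log T / (θ' - θ) ^ 2 < B.pulls j (t - 1) w) :
    w ∈ B.overestimate c ω θ j t ∪ B.underestimate c ω θ' istar t := by
  by_contra! hnot
  have ht1 : (1 : ℝ) < t := by exact_mod_cast (by omega : 1 < t)
  have hlog : 0 < Real.log t := Real.log_pos ht1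
  have hpos : ∀ i, 0 < B.pulls i (t - 1) w := fun i => by
    exact_mod_cast (mul_pos hc hlog).trans_le (hn i)
  obtain ⟨h1, h2⟩ := not_or.1 hnot
  have hm1 := B.median_le_of_notMem_manyHits (hpos j) fun hm => h1 ⟨hn j, hm⟩
  have hm2 := B.le_median_of_notMem_manyHits (hpos istar) fun hm => h2 ⟨hn istar, hm⟩
  have hucb := h.ucb t ht hex istar
  simp only [harm, ucbIndex] at hucb
  change _ + Real.sqrt (ω * Real.log t / (B.pulls istar (t - 1) w : ℝ)) ≤
    _ + Real.sqrt (ω * Real.log t / (B.pulls j (t - 1) w : ℝ)) at hucb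
  have hn0 : (0 : ℝ) < B.pulls j (t - 1) w := by exact_mod_cast hpos j
  -- The radius of the optimal arm cancels: its index is at least `θ'`, and that of `j` at most `θ`
  -- plus twice the radius of `j`.
  have hle : (θ' - θ) / 2 ≤ Real.sqrt (ω * Real.log t / (B.pulls j (t - 1) w : ℝ)) := by
    linarith
  have hd : 0 < θ' - θ := sub_pos.2 hθ
  rw [Real.le_sqrt' (by positivity), le_div_iff₀ hn0] at hle
  rw [div_lt_iff₀ (by positivity)] at hlarge
  have hmono : ω * Real.log t ≤ ω * Real.log T := by gcongr
  nlinarith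

open Classical in
/-- Pathwise bound on the number of pulls of a suboptimal arm. -/
lemma pulls_le {b ω : ℝ} {G : ℕ} {w : Ω} {j istar : Fin K} {θ θ' : ℝ}
    (h : IsMedEUCB b ω G (fun t => B.arm t w) (fun t => B.observed t w)) (hω : 0 ≤ ω)
    (hK : 2 ≤ K) (hb : 8 ≤ b) (hG : 2 ≤ G) (hKG : (K : ℝ) * b * Real.log G ≤ G)
    (hθ : θ < θ') {T : ℕ} (hGT : G < T) :
    (B.pulls j T w : ℝ) ≤ b * Real.log (2 * T) + 4 * ω * Real.log T / (θ' - θ) ^ 2 + 2 +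
      ∑ t ∈ Finset.Icc 1 T, if w ∈ B.overestimate (b / 4) ω θ j t ∪
        B.underestimate (b / 4) ω θ' istar t then (1 : ℝ) else 0 := by
  set I : ℕ → Fin K := fun t => B.arm t w with hI
  set u : ℝ := 4 * ω * Real.log T / (θ' - θ) ^ 2 with hu
  have hlogT : 0 ≤ Real.log T := Real.log_natCast_nonneg T
  have hu0 : 0 ≤ u := by positivity
  set E : ℕ → Set Ω := fun t => B.overestimate (b / 4) ω θ j t ∪
    B.underestimate (b / 4) ω θ' istar t with hE
  have hL : 1 ≤ exploreLevel b G 1 := by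
    refine Nat.one_le_ceil_iff.2 (mul_pos (by linarith) (Real.log_pos ?_))
    exact_mod_cast (by omega : 1 < 1 * G)
  have hsub : pullTimes I j T ⊆
      ((pullTimes I j T).filter fun t => t ≤ K * exploreLevel b G 1 ∨ IsExploration K b G t) ∪
      ((pullTimes I j T).filter fun t => numPulls I j (t - 1) ≤ ⌊u⌋₊) ∪
      ((Finset.Icc 1 T).filter fun t => w ∈ E t) := by
    intro t ht
    obtain ⟨htT, harm⟩ := Finset.mem_filter.1 ht
    rw [Finset.mem_union, Finset.mem_union, Finset.mem_filter, Finset.mem_filter,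
      Finset.mem_filter]
    by_cases hf : t ≤ K * exploreLevel b G 1 ∨ IsExploration K b G t
    · exact Or.inl (Or.inl ⟨ht, hf⟩)
    by_cases hs : numPulls I j (t - 1) ≤ ⌊u⌋₊
    · exact Or.inl (Or.inr ⟨ht, hs⟩)
    rw [not_or, not_le] at hf
    have ht2 : 2 ≤ t := by nlinarith
    exact Or.inr ⟨htT, B.mem_estimate_of_pull h hω (by linarith) hθ hf.1 ht2
      (Finset.mem_Icc.1 htT).2 hf.2 harm (fun i => h.le_numPulls hK hb hG hKG i hf.1)
      ((Nat.floor_lt hu0).1 (not_le.1 hs))⟩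
  have hcard := (Finset.card_le_card hsub).trans ((Finset.card_union_le _ _).trans
    (add_le_add (Finset.card_union_le _ _) le_rfl))
  have h1 := h.card_forced_le (j := j) (by linarith) (by omega : 1 ≤ G) T
  have h2 := card_pulls_of_numPulls_le (I := I) (j := j) T ⌊u⌋₊
  have h3 := exploreLevel_last_le (b := b) (by linarith) (by omega : 1 ≤ G) hGT.le
  have h4 : (⌊u⌋₊ : ℝ) ≤ u := Nat.floor_le hu0
  have h5 : B.pulls j T w ≤ exploreLevel b G (T / G + 1) + (⌊u⌋₊ + 1) +
      ((Finset.Icc 1 T).filter fun t => w ∈ E t).card :=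
    hcard.trans (add_le_add (add_le_add h1 h2) le_rfl)
  have h6 : (B.pulls j T w : ℝ) ≤ exploreLevel b G (T / G + 1) + (⌊u⌋₊ + 1) +
      (((Finset.Icc 1 T).filter fun t => w ∈ E t).card : ℝ) := by exact_mod_cast h5
  rw [Finset.sum_boole]
  linarith

lemma measurable_pulls (j : Fin K) (t : ℕ) : Measurable (B.pulls j t) := by
  classical
  have : B.pulls j t = fun w => ∑ τ ∈ Finset.Icc 1 t, if B.arm τ w = j then 1 else 0 := by
    ext w
    rw [pulls, numPulls, pullTimes, Finset.card_filter]
  rw [this]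
  refine Finset.measurable_sum _ fun τ hτ => ?_
  obtain ⟨σ, rfl⟩ : ∃ σ, τ = σ + 1 := ⟨τ - 1, by have := (Finset.mem_Icc.1 hτ).1; omega⟩
  refine Measurable.ite (B.ℱ.le σ _ ?_) measurable_const measurable_const
  exact B.measurable_arm σ (measurableSet_singleton j)

lemma integrable_pulls [IsProbabilityMeasure P] (j : Fin K) (t : ℕ) :
    Integrable (fun w => (B.pulls j t w : ℝ)) P := by
  refine Integrable.of_bound
    (measurable_from_nat.comp (B.measurable_pulls j t)).aestronglyMeasurable t
    (Filter.Eventually.of_forall fun w => ?_)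
  rw [Real.norm_of_nonneg (by positivity)]
  exact_mod_cast numPulls_le t

/-- Bound on the expected number of pulls of a suboptimal arm. -/
lemma integral_pulls_le [IsProbabilityMeasure P] [∀ i, IsProbabilityMeasure (ν i)]
    {istar : Fin K} {s l ξ b ω : ℝ} {G : ℕ} (hgap : QuantileGap ν istar s l ξ) (hρ0 : 0 ≤ ρ)
    (hρ : ρ < s) (hb1 : ω / ξ ^ 2 ≤ b) (hb2 : 2 / (s - ρ) ^ 2 ≤ b) (hω : 2 / l ^ 2 ≤ ω)
    (hG : 2 ≤ G) (hKG : (K : ℝ) * b * Real.log G ≤ G) (hB : B.PlaysMedEUCB b ω G) {j : Fin K}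
    (hj : j ≠ istar) {T : ℕ} (hGT : G < T) :
    ∫ w, (B.pulls j T w : ℝ) ∂P ≤ b * Real.log (2 * T) + 4 * ω * Real.log T /
      (quantile (cdf (ν istar)) (1 / 2 - s) - quantile (cdf (ν j)) (1 / 2 + s)) ^ 2 +
        (2 + 2 * Real.pi ^ 2 / 3) := by
  classical
  have hl := hgap.l_pos
  have hs := hgap.s_lt_half
  have hsρ : 0 < s - ρ := sub_pos.2 hρ
  have hω0 : 0 ≤ ω := (by positivity : 0 ≤ 2 / l ^ 2).trans hω
  -- `0 < s - ρ < 1/2`, so `2 / (s - ρ) ^ 2` exceeds 8.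
  have hb : 8 ≤ b := by
    refine le_trans ?_ hb2
    rw [le_div_iff₀ (by positivity)]
    nlinarith
  have hK : 2 ≤ K := by
    by_contra! hlt
    exact hj (Fin.ext (by have := j.2; have := istar.2; omega))
  set θ := quantile (cdf (ν j)) (1 / 2 + s)
  set θ' := quantile (cdf (ν istar)) (1 / 2 - s)
  -- Measurable hulls have the same measure and spare a measurability proof for the events.
  set E : ℕ → Set Ω := fun t => toMeasurable P (B.overestimate (b / 4) ω θ j t ∪
    B.underestimate (b / 4) ω θ' istar t) with hE
  have hEm : ∀ t, MeasurableSet (E t) := fun t => measurableSet_toMeasurable _ _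
  have hPE : ∀ t ∈ Finset.Icc 1 T, P.real (E t) ≤ 2 * (1 / (t : ℝ) ^ 2) := by
    intro t ht
    have ht1 := (Finset.mem_Icc.1 ht).1
    calc P.real (E t) = P.real (B.overestimate (b / 4) ω θ j t ∪
          B.underestimate (b / 4) ω θ' istar t) := by
          rw [measureReal_def, measure_toMeasurable, ← measureReal_def]
      _ ≤ _ := measureReal_union_le _ _
      _ ≤ 1 / (t : ℝ) ^ 2 + 1 / (t : ℝ) ^ 2 := add_le_add
          (B.measureReal_overestimate_le hgap hρ0 hρ hb1 hb2 hω hj ht1)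
          (B.measureReal_underestimate_le hgap hρ0 hρ hb1 hb2 hω ht1)
      _ = _ := by ring
  set a : ℝ := b * Real.log (2 * T) + 4 * ω * Real.log T / (θ' - θ) ^ 2 with ha
  have hi : ∀ t, Integrable ((E t).indicator fun _ => (1 : ℝ)) P :=
    fun t => (integrable_const 1).indicator (hEm t)
  have hisum : Integrable (fun w => ∑ t ∈ Finset.Icc 1 T, (E t).indicator (fun _ => (1 : ℝ)) w) P :=
    integrable_finsetSum _ fun t _ => hi t
  have hpath : ∀ w, (B.pulls j T w : ℝ) ≤
      a + 2 + ∑ t ∈ Finset.Icc 1 T, (E t).indicator (fun _ => (1 : ℝ)) w := by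
    intro w
    refine (B.pulls_le (istar := istar) (hB w) hω0 hK hb hG hKG (hgap.gap j hj) hGT).trans ?_
    refine add_le_add le_rfl (Finset.sum_le_sum fun t _ => ?_)
    split_ifs with hw
    · rw [Set.indicator_of_mem (subset_toMeasurable _ _ hw)]
    · exact Set.indicator_nonneg (fun _ _ => zero_le_one) _
  calc ∫ w, (B.pulls j T w : ℝ) ∂P
      ≤ ∫ w, (a + 2 + ∑ t ∈ Finset.Icc 1 T, (E t).indicator (fun _ => (1 : ℝ)) w) ∂P :=
        integral_mono (B.integrable_pulls j T) ((integrable_const _).add hisum) hpath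
    _ = a + 2 + ∑ t ∈ Finset.Icc 1 T, P.real (E t) := by
        rw [integral_add (integrable_const _) hisum, integral_finsetSum _ fun t _ => hi t]
        simp only [integral_const, probReal_univ, one_smul]
        congr 1
        refine Finset.sum_congr rfl fun t _ => ?_
        rw [integral_indicator_const _ (hEm t), smul_eq_mul, mul_one]
    _ ≤ a + 2 + ∑ t ∈ Finset.Icc 1 T, 2 * (1 / (t : ℝ) ^ 2) := by
        gcongr with t ht
        exact hPE t ht
    _ ≤ a + (2 + 2 * Real.pi ^ 2 / 3) := by
        rw [← Finset.mul_sum]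
        -- The sum contributes only `π² / 3`, half of what the stated constant allows.
        nlinarith [sum_one_div_sq_le T, sq_nonneg Real.pi]

/-- The regret decomposes according to the suboptimal arms. -/
lemma pseudoRegret_eq [IsProbabilityMeasure P] (istar : Fin K) (T : ℕ) :
    B.pseudoRegret istar T = ∑ j ∈ Finset.univ.erase istar,
      (mean (ν istar) - mean (ν j)) * ∫ w, (B.pulls j T w : ℝ) ∂P := by
  classical
  have hsum : ∀ w, ∑ t ∈ Finset.Icc 1 T, mean (ν (B.arm t w)) =
      ∑ j, mean (ν j) * (B.pulls j T w : ℝ) := by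
    intro w
    rw [← Finset.sum_fiberwise (Finset.Icc 1 T) (fun t => B.arm t w)]
    refine Finset.sum_congr rfl fun j _ => ?_
    rw [Finset.sum_congr rfl fun t ht => by rw [(Finset.mem_filter.1 ht).2], Finset.sum_const,
      nsmul_eq_mul, mul_comm]
    rfl
  have htotal : ∀ w, ∑ j, (B.pulls j T w : ℝ) = T := by
    intro w
    have h := Finset.card_eq_sum_card_fiberwise (s := Finset.Icc 1 T) (t := Finset.univ)
      (f := fun t => B.arm t w) (fun _ _ => by simp)
    rw [Nat.card_Icc, Nat.add_sub_cancel] at h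
    exact_mod_cast h.symm
  have hTint : (T : ℝ) = ∑ j, ∫ w, (B.pulls j T w : ℝ) ∂P := by
    rw [← integral_finsetSum _ fun j _ => B.integrable_pulls j T]
    simp [htotal]
  rw [pseudoRegret]
  simp_rw [hsum]
  rw [integral_finsetSum _ fun j _ => (B.integrable_pulls j T).const_mul _, hTint, Finset.mul_sum,
    ← Finset.sum_sub_distrib]
  rw [← Finset.add_sum_erase _ _ (Finset.mem_univ istar), integral_const_mul, sub_self, zero_add]
  refine Finset.sum_congr rfl fun j _ => ?_
  rw [integral_const_mul, sub_mul]

end AttackedBandit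

end MedBandit

/-! ### The regret bound -/

theorem theorem1 {K : ℕ} (ν : Fin K → Measure ℝ) [∀ i, IsProbabilityMeasure (ν i)]
    (hint : ∀ i, Integrable (fun x : ℝ => x) (ν i))
    (istar : Fin K) (hopt : ∀ j, j ≠ istar → MedBandit.mean (ν j) < MedBandit.mean (ν istar))
    (s b ω : ℝ) :
    ∃ M : ℝ, 0 < M ∧ ∃ ζ : ℝ, 0 < ζ ∧
      ∀ (l ξ ρ : ℝ) (G : ℕ),
        MedBandit.QuantileGap ν istar s l ξ →
        0 ≤ ρ → ρ < s →
        max (ω / ξ ^ 2) (2 / (s - ρ) ^ 2) ≤ b →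
        2 / l ^ 2 ≤ ω →
        2 ≤ G → (K : ℝ) * b * Real.log G ≤ G →
        ∀ (Ω : Type*) [MeasurableSpace Ω] (P : Measure Ω) [IsProbabilityMeasure P]
          (B : MedBandit.AttackedBandit ν ρ P), B.PlaysMedEUCB b ω G →
          ∀ T : ℕ, G < T →
            B.pseudoRegret istar T ≤
              ∑ j ∈ Finset.univ.erase istar,
                (MedBandit.mean (ν istar) - MedBandit.mean (ν j)) *
                  (b * Real.log (2 * T) +
                    4 * ω * Real.log T /
                      (MedBandit.quantile (cdf (ν istar)) (1 / 2 - s) -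
                        MedBandit.quantile (cdf (ν j)) (1 / 2 + s)) ^ 2 +
                    (2 + 2 * Real.pi ^ 2 / 3)) ∧
            (ζ ≤ T → B.pseudoRegret istar T ≤ M * Real.log T) := by
  -- `M` is fixed before any sign of `b` and `ω` is known, hence the absolute values. Since `T > G ≥
  -- 2` forces `T ≥ 3 > e`, constants are at most multiples of `log T`, and `ζ = 1` suffices.
  set c : Fin K → ℝ := fun j => 2 * |b| + 4 * |ω| /
    (MedBandit.quantile (cdf (ν istar)) (1 / 2 - s) -
      MedBandit.quantile (cdf (ν j)) (1 / 2 + s)) ^ 2 + (2 + 2 * Real.pi ^ 2 / 3) with hc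
  have hΔ : ∀ j ∈ Finset.univ.erase istar,
      0 ≤ MedBandit.mean (ν istar) - MedBandit.mean (ν j) :=
    fun j hj => sub_nonneg.2 (hopt j (Finset.ne_of_mem_erase hj)).le
  have hM : 0 ≤ ∑ j ∈ Finset.univ.erase istar,
      (MedBandit.mean (ν istar) - MedBandit.mean (ν j)) * c j :=
    Finset.sum_nonneg fun j hj => mul_nonneg (hΔ j hj) (by positivity)
  refine ⟨∑ j ∈ Finset.univ.erase istar,
    (MedBandit.mean (ν istar) - MedBandit.mean (ν j)) * c j + 1, by linarith, 1, one_pos, ?_⟩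
  intro l ξ ρ G hgap hρ0 hρ hb hω hG hKG Ω _ P _ B hB T hGT
  have hbound := (B.pseudoRegret_eq istar T).le.trans (Finset.sum_le_sum fun j hj =>
    mul_le_mul_of_nonneg_left (B.integral_pulls_le hgap hρ0 hρ ((le_max_left _ _).trans hb)
      ((le_max_right _ _).trans hb) hω hG hKG hB (Finset.ne_of_mem_erase hj) hGT) (hΔ j hj))
  refine ⟨hbound, fun _ => ?_⟩
  have hT3 : (3 : ℝ) ≤ T := by exact_mod_cast (by omega : 3 ≤ T)
  have hlog1 : 1 ≤ Real.log T := by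
    rw [Real.le_log_iff_exp_le (by linarith)]
    linarith [Real.exp_one_lt_d9]
  have hlog2 : Real.log (2 * T) ≤ 2 * Real.log T := by
    rw [Real.log_mul (by norm_num) (by positivity), two_mul]
    gcongr
    linarith
  have hlog0 : 0 ≤ Real.log (2 * T) := Real.log_nonneg (by linarith)
  calc B.pseudoRegret istar T ≤ _ := hbound
    _ ≤ ∑ j ∈ Finset.univ.erase istar,
        (MedBandit.mean (ν istar) - MedBandit.mean (ν j)) * (c j * Real.log T) := by
      refine Finset.sum_le_sum fun j hj => mul_le_mul_of_nonneg_left ?_ (hΔ j hj)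
      rw [hc]
      dsimp only
      rw [add_mul, add_mul]
      refine add_le_add (add_le_add ?_ ?_) (le_mul_of_one_le_right (by positivity) hlog1)
      · calc b * Real.log (2 * T) ≤ |b| * (2 * Real.log T) := by
              gcongr
              exact le_abs_self b
          _ = _ := by ring
      · rw [div_mul_eq_mul_div]
        gcongr
        exact le_abs_self ω
    _ = (∑ j ∈ Finset.univ.erase istar,
        (MedBandit.mean (ν istar) - MedBandit.mean (ν j)) * c j) * Real.log T := by
      rw [Finset.sum_mul]
      exact Finset.sum_congr rfl fun j _ => (mul_assoc _ _ _).symm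
    _ ≤ _ := by
      gcongr
      linarith
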